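/- Let $\ell:[0,1]\times[0,1]\to[0,\infty)$ be a loss function that is $L$-Lipschitz in each argument, where $L>0$: $|\ell(x,y)-\ell(x',y)|\le L|x-x'|$ and $|\ell(x,y)-\ell(x,y')|\le L|y-y'|$ for all $x,x',y,y'\in[0,1]$. For $A,B\in[0,1]^{n\times m}$ put $\ell(A,B)=\frac1{nm}\sum_{i,j}\ell(A(i,j),B(i,j))$. For a distribution $P$ on $[0,1]^{n\times m}$ let $\ell(A,P)=\mathbb E_{Y\sim P}[\ell(A,Y)]$ be the true loss, and for a sample $S=(B_1,\dots,B_T)$ of matrices in $[0,1]^{n\times m}$ let $\ell(A,S)=\frac1T\sum_{t=1}^T\ell(A,B_t)$ be the empirical loss. For $\bar\pi\in[0,1]^{n\times m}$ let $\mathcal D_{\bar\pi}$ be the distribution of a random matrix in $\{0,1\}^{n\times m}$ with independent entries, the $(i,j)$ entry being $1$ with probability $\bar\pi(i,j)$. Let $\|\cdot\|_{\mathrm{tr}}$ denote the trace norm (the sum of the singular values). Theorem. There is a universal constant $c>0$ such that the following holds for all integers $m\ge n\ge1$ and $T\ge1$, every $L>0$, every loss $\ell$ as above that is $L$-Lipschitz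 in each argument, every $\bar\pi\in[0,1]^{n\times m}$, every $\gamma\in\mathbb R$ and every $\delta\in(0,1)$. If $S=(B_1,\dots,B_T)\sim\mathcal D_{\bar\pi}^{T}$ is an i.i.d. sample, then with probability at least $1-\delta$, simultaneously for all $\pi\in[0,1]^{n\times m}$ with $\|\pi\|_{\mathrm{tr}}\le\gamma$, $$|\ell(\pi,\mathcal D_{\bar\pi})-\ell(\pi,S)|\le c\,\frac{L\gamma}{n\sqrt{mT}}+L\sqrt{\frac{\ln(2/\delta)}{2Tmn}}.$$ Moreover, the squared loss $\ell(x,y)=(x-y)^2$ is nonnegative and $2$-Lipschitz in each argument on $[0,1]\times[0,1]$, so that the bound applies to it with $L=2$. -/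

import Mathlib

open MeasureTheory ProbabilityTheory unitInterval

noncomputable section

namespace MatrixLoss

/-- The set `[0,1]^{n × m}` of `n × m` matrices with entries in the unit interval, with the product
σ-algebra. -/
abbrev UnitMatrix (n m : ℕ) : Type := Fin n → Fin m → I

/-- The trace (nuclear) norm of a matrix: the sum of its singular values. -/
def traceNorm {n m : ℕ} (A : Matrix (Fin n) (Fin m) ℝ) : ℝ :=
  (Matrix.toEuclideanLin A).singularValues.sum fun _ s => s

/-- An element of `[0,1]^{n × m}` viewed as a real matrix. -/
def UnitMatrix.toReal {n m : ℕ} (X : UnitMatrix n m) : Matrix (Fin n) (Fin m) ℝ :=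
  Matrix.of fun i j => (X i j : ℝ)

/-- A nonnegative loss function on `[0,1] × [0,1]` that is `L`-Lipschitz in each of its two
arguments. -/
structure IsLipschitzLoss (L : ℝ) (loss : I → I → ℝ) : Prop where
  nonneg : ∀ x y, 0 ≤ loss x y
  lipschitz_left : ∀ x x' y, |loss x y - loss x' y| ≤ L * |(x : ℝ) - (x' : ℝ)|
  lipschitz_right : ∀ x y y', |loss x y - loss x y'| ≤ L * |(y : ℝ) - (y' : ℝ)|

/-- The squared loss `(x - y)²`. -/
def squaredLoss (x y : I) : ℝ := ((x : ℝ) - (y : ℝ)) ^ 2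

/-- The loss `ℓ(A, B)` between two matrices: the average of the entrywise losses. -/
def matrixLoss {n m : ℕ} (loss : I → I → ℝ) (A B : UnitMatrix n m) : ℝ :=
  (1 / ((n : ℝ) * (m : ℝ))) * ∑ i, ∑ j, loss (A i j) (B i j)

/-- The true loss `ℓ(X, P) = 𝔼_{Y ∼ P} ℓ(X, Y)`. -/
def trueLoss {n m : ℕ} (loss : I → I → ℝ) (X : UnitMatrix n m) (P : Measure (UnitMatrix n m)) : ℝ :=
  ∫ Y, matrixLoss loss X Y ∂P

/-- The empirical loss `ℓ(X, S)`: the average of `ℓ(X, B_t)` over the sample `S = (B_1, …, B_T)`. -/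
def empiricalLoss {n m T : ℕ} (loss : I → I → ℝ) (X : UnitMatrix n m)
    (S : Fin T → UnitMatrix n m) : ℝ :=
  (1 / (T : ℝ)) * ∑ t, matrixLoss loss X (S t)

/-- The distribution `𝒟_π` of a random binary matrix with independent entries, the `(i,j)` entry
being `1` with probability `π(i,j)` and `0` with probability `1 - π(i,j)`. -/
def bernoulliMatrix {n m : ℕ} (p : UnitMatrix n m) : Measure (UnitMatrix n m) :=
  Measure.pi fun i => Measure.pi fun j => bernoulliMeasure (1 : I) 0 (p i j)

/-- The law of an i.i.d. sample `(B_1, …, B_T)` from `𝒟_π`. -/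
def sampleLaw {n m : ℕ} (T : ℕ) (p : UnitMatrix n m) : Measure (Fin T → UnitMatrix n m) :=
  Measure.pi fun _ => bernoulliMatrix p

end MatrixLoss

end

namespace MatrixLoss

/-! The sample is binary, so true loss minus empirical loss is a linear form in the `n * m * T`
independent centred variables `p - b`, with coefficients `(loss x 1 - loss x 0) / (n * m * T)`.
These are at most `L / (n * m * T)` in size, so by McDiarmid (`bernExp_mcdiarmid`) the supremum over
the trace norm ball exceeds its mean by the square-root term with probability at most `δ / 2`; the
negated form gives the other side.

The mean is bounded in two moves. `bernExp_iSup_le` performs symmetrization and contraction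
together, coordinate by coordinate: since `x ↦ loss x 1 - loss x 0` is `2 * L`-Lipschitz, the
process is dominated by the Rademacher process with coefficients `2 * L * x / (n * m * T)`. Duality
of trace and operator norm (`sum_mul_le_traceNorm_mul`) then leaves `γ` times the expected operator
norm of a sum of `T` sign matrices, at most `140 * √(m * T)` by a net argument
(`bernExp_euclideanOpNorm_signSum_le`). The product is `280 * L * γ / (n * √(m * T))`.

All probabilities are computed as finite sums over Boolean arrays, so suprema raise no measurability
question; `bernExp_indicator_le_sampleLaw` returns to the sample law. -/

/-! ### Expectations under finite products of Bernoulli distributions -/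

/-- The mass that the Bernoulli distribution with parameter `p` gives to `b`. -/
def bernWeight (p : ℝ) (b : Bool) : ℝ := if b then p else 1 - p

/-- The expectation of `F` under the product of the Bernoulli distributions with parameters `p k`. -/
def bernExp {ι : Type*} [Fintype ι] [DecidableEq ι] (p : ι → ℝ) (F : (ι → Bool) → ℝ) : ℝ :=
  ∑ ω, (∏ k, bernWeight (p k) (ω k)) * F ω

lemma bernWeight_nonneg {p : ℝ} (hp : p ∈ Set.Icc (0 : ℝ) 1) (b : Bool) : 0 ≤ bernWeight p b := by
  cases b
  · simpa [bernWeight] using hp.2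
  · simpa [bernWeight] using hp.1

section bernExp

variable {ι : Type*} [Fintype ι] [DecidableEq ι] {p : ι → ℝ}

lemma bernExp_mono (hp : ∀ k, p k ∈ Set.Icc (0 : ℝ) 1) {F G : (ι → Bool) → ℝ}
    (h : ∀ ω, F ω ≤ G ω) : bernExp p F ≤ bernExp p G :=
  Finset.sum_le_sum fun ω _ => mul_le_mul_of_nonneg_left (h ω)
    (Finset.prod_nonneg fun k _ => bernWeight_nonneg (hp k) _)

lemma bernExp_add (F G : (ι → Bool) → ℝ) :
    bernExp p (fun ω => F ω + G ω) = bernExp p F + bernExp p G := by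
  simp [bernExp, mul_add, Finset.sum_add_distrib]

lemma bernExp_const_mul (c : ℝ) (F : (ι → Bool) → ℝ) :
    bernExp p (fun ω => c * F ω) = c * bernExp p F := by
  simp only [bernExp, Finset.mul_sum]
  exact Finset.sum_congr rfl fun ω _ => by ring

lemma bernExp_sum {κ : Type*} (s : Finset κ) (F : κ → (ι → Bool) → ℝ) :
    bernExp p (fun ω => ∑ a ∈ s, F a ω) = ∑ a ∈ s, bernExp p (F a) := by
  simp only [bernExp, Finset.mul_sum]
  exact Finset.sum_comm

lemma bernExp_prod (f : ι → Bool → ℝ) :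
    bernExp p (fun ω => ∏ k, f k (ω k)) = ∏ k, ((1 - p k) * f k false + p k * f k true) := by
  simp only [bernExp, ← Finset.prod_mul_distrib]
  rw [← Fintype.prod_sum fun k b => bernWeight (p k) b * f k b]
  exact Finset.prod_congr rfl fun k _ => by simp [bernWeight, add_comm]

lemma bernExp_one : bernExp p (fun _ => 1) = 1 := by
  simpa using bernExp_prod (p := p) (fun _ _ => 1)

lemma bernExp_const (c : ℝ) : bernExp p (fun _ => c) = c := by
  simpa [bernExp_one] using bernExp_const_mul (p := p) c fun _ => 1

lemma bernExp_congr_equiv {κ : Type*} [Fintype κ] [DecidableEq κ] (e : κ ≃ ι)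
    (F : (κ → Bool) → ℝ) :
    bernExp p (fun ω => F (ω ∘ e)) = bernExp (p ∘ e) F := by
  refine Fintype.sum_equiv (e.symm.arrowCongr (Equiv.refl Bool)) _ _ fun ω => ?_
  rw [← e.prod_comp]
  rfl

/-- Jensen's inequality for the exponential function, in the softmax form. -/
lemma bernExp_le_of_exp (hp : ∀ k, p k ∈ Set.Icc (0 : ℝ) 1) {s a : ℝ} (hs : 0 < s)
    {F : (ι → Bool) → ℝ} (h : bernExp p (fun ω => Real.exp (s * F ω)) ≤ Real.exp a) :
    bernExp p F ≤ a / s := by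
  -- The tangent line of the exponential at `a` lies below its graph.
  have key : bernExp p (fun ω => Real.exp a * (s * F ω - a + 1)) ≤ Real.exp a := by
    refine (bernExp_mono hp fun ω => ?_).trans h
    calc Real.exp a * (s * F ω - a + 1) ≤ Real.exp a * Real.exp (s * F ω - a) := by
          gcongr
          exact Real.add_one_le_exp _
      _ = Real.exp (s * F ω) := by rw [← Real.exp_add]; congr 1; ring
  rw [bernExp_const_mul] at key
  have h1 : bernExp p (fun ω => s * F ω - a + 1) = s * bernExp p F + (-a + 1) := by
    rw [← bernExp_const_mul, ← bernExp_const (p := p) (-a + 1), ← bernExp_add]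
    congr 1
    ext ω
    ring
  rw [h1] at key
  have h2 := le_of_mul_le_mul_left (key.trans_eq (mul_one _).symm) (Real.exp_pos a)
  rw [le_div_iff₀ hs]
  linarith

end bernExp

lemma bernExp_zero (p : Fin 0 → ℝ) (F : (Fin 0 → Bool) → ℝ) : bernExp p F = F default := by
  simp only [bernExp, Fintype.sum_unique, Finset.univ_eq_empty, Finset.prod_empty, one_mul]
  exact congrArg F (Subsingleton.elim _ _)

lemma bernExp_succ {N : ℕ} (p : Fin (N + 1) → ℝ) (F : (Fin (N + 1) → Bool) → ℝ) :
    bernExp p F =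
      (1 - p 0) * bernExp (fun k => p k.succ) (fun ω => F (Fin.cons false ω)) +
        p 0 * bernExp (fun k => p k.succ) (fun ω => F (Fin.cons true ω)) := by
  simp only [bernExp]
  rw [← (Fin.consEquiv fun _ : Fin (N + 1) => Bool).sum_comp, Fintype.sum_prod_type]
  simp only [Fin.consEquiv, Equiv.coe_fn_mk, Fin.prod_univ_succ, Fin.cons_zero, Fin.cons_succ,
    Fintype.sum_bool, mul_assoc, ← Finset.mul_sum]
  simp [bernWeight, add_comm]

/-! ### Concentration: Hoeffding and McDiarmid -/

/-- Hoeffding's lemma for a random variable with two values. -/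
lemma hoeffding_two_values {p : ℝ} (hp : p ∈ Set.Icc (0 : ℝ) 1) (a b s : ℝ) :
    (1 - p) * Real.exp (s * a) + p * Real.exp (s * b) ≤
      Real.exp (s * ((1 - p) * a + p * b) + s ^ 2 * (b - a) ^ 2 / 8) := by
  set μ : Measure ℝ := bernoulliMeasure b a ⟨p, hp⟩ with hμ
  have h := hasSubgaussianMGF_of_mem_Icc (μ := μ) (X := id) (a := min a b) (b := max a b)
    aemeasurable_id (by
      have h0 : μ (Set.Icc (min a b) (max a b))ᶜ = 0 := by
        rw [hμ, bernoulliMeasure_apply_of_notMem_of_notMem _ measurableSet_Icc.compl] <;> simp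
      exact h0)
  have h2 := h.mgf_le s
  have hm : μ[id] = (1 - p) * a + p * b := by
    rw [hμ, integral_bernoulliMeasure]
    simp
    ring
  rw [mgf, hμ, integral_bernoulliMeasure, ← hμ, hm] at h2
  have h3 : (max a b - min a b) ^ 2 = (b - a) ^ 2 := by
    rw [max_sub_min_eq_abs, sq_abs]
  have h4 : (((‖max a b - min a b‖₊ / 2) ^ 2 : NNReal) : ℝ) = (b - a) ^ 2 / 4 := by
    push_cast
    rw [Real.norm_eq_abs, div_pow, sq_abs, h3]
    norm_num
  rw [h4] at h2
  simp only [smul_eq_mul, id] at h2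
  have h5 := mul_le_mul_of_nonneg_right h2 (Real.exp_pos (s * ((1 - p) * a + p * b))).le
  rw [add_mul, mul_assoc, mul_assoc, ← Real.exp_add, ← Real.exp_add, ← Real.exp_add] at h5
  ring_nf at h5 ⊢
  linarith

/-- The bounded differences bound on the moment generating function. -/
lemma bernExp_exp_le {N : ℕ} {p : Fin N → ℝ} (hp : ∀ k, p k ∈ Set.Icc (0 : ℝ) 1) {c : ℝ}
    {F : (Fin N → Bool) → ℝ} (hF : ∀ ω k b, |F (Function.update ω k b) - F ω| ≤ c) (s : ℝ) :
    bernExp p (fun ω => Real.exp (s * F ω)) ≤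
      Real.exp (s * bernExp p F + s ^ 2 * (N * c ^ 2) / 8) := by
  induction N with
  | zero => simp [bernExp_zero]
  | succ N ih =>
    set q : Fin N → ℝ := fun k => p k.succ with hq
    have hq' : ∀ k, q k ∈ Set.Icc (0 : ℝ) 1 := fun k => hp _
    have hrest : ∀ b : Bool, bernExp q (fun ω => Real.exp (s * F (Fin.cons b ω))) ≤
        Real.exp (s * bernExp q (fun ω => F (Fin.cons b ω)) + s ^ 2 * (N * c ^ 2) / 8) := by
      intro b
      refine ih hq' fun ω k b' => ?_
      rw [Fin.cons_update]
      exact hF _ _ _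
    -- `g` is the conditional mean given the first coordinate. As an average of functions
    -- oscillating by at most `c` in that coordinate, it does so too, and the two-valued Hoeffding
    -- lemma applies to it.
    set g : Bool → ℝ := fun b => bernExp q (fun ω => F (Fin.cons b ω)) with hg
    have hgd : |g true - g false| ≤ c := by
      have h1 : ∀ ω : Fin N → Bool, |F (Fin.cons true ω) - F (Fin.cons false ω)| ≤ c := by
        intro ω
        have := hF (Fin.cons false ω) 0 true
        rwa [Fin.update_cons_zero] at this
      rw [abs_le]
      constructor
      · have : g false ≤ g true + c := by
          rw [hg, ← bernExp_const (p := q) c, ← bernExp_add]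
          refine bernExp_mono hq' fun ω => ?_
          linarith [(abs_le.1 (h1 ω)).1]
        linarith
      · have : g true ≤ g false + c := by
          rw [hg, ← bernExp_const (p := q) c, ← bernExp_add]
          refine bernExp_mono hq' fun ω => ?_
          linarith [(abs_le.1 (h1 ω)).2]
        linarith
    rw [bernExp_succ, bernExp_succ]
    have hp0 := hp 0
    calc _ ≤ (1 - p 0) * Real.exp (s * g false + s ^ 2 * (N * c ^ 2) / 8) +
          p 0 * Real.exp (s * g true + s ^ 2 * (N * c ^ 2) / 8) :=
          add_le_add (mul_le_mul_of_nonneg_left (hrest false) (by linarith [hp0.2]))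
            (mul_le_mul_of_nonneg_left (hrest true) hp0.1)
      _ = ((1 - p 0) * Real.exp (s * g false) + p 0 * Real.exp (s * g true)) *
          Real.exp (s ^ 2 * (N * c ^ 2) / 8) := by
          rw [Real.exp_add, Real.exp_add]; ring
      _ ≤ Real.exp (s * ((1 - p 0) * g false + p 0 * g true) +
            s ^ 2 * (g true - g false) ^ 2 / 8) * Real.exp (s ^ 2 * (N * c ^ 2) / 8) := by
          gcongr
          exact hoeffding_two_values hp0 _ _ _
      _ ≤ _ := by
          rw [← Real.exp_add]
          have h3 : (g true - g false) ^ 2 ≤ c ^ 2 := sq_le_sq' (abs_le.1 hgd).1 (abs_le.1 hgd).2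
          have h4 := mul_le_mul_of_nonneg_left h3 (sq_nonneg s)
          apply Real.exp_le_exp.2
          push_cast
          linarith

/-- McDiarmid's inequality for a product of Bernoulli distributions. -/
lemma bernExp_mcdiarmid {ι : Type*} [Fintype ι] [DecidableEq ι] {p : ι → ℝ}
    (hp : ∀ k, p k ∈ Set.Icc (0 : ℝ) 1) {c : ℝ} {F : (ι → Bool) → ℝ}
    (hF : ∀ ω k b, |F (Function.update ω k b) - F ω| ≤ c) {ε : ℝ} (hε : 0 ≤ ε)
    (hc : 0 < Fintype.card ι * c ^ 2) :
    bernExp p (fun ω => if bernExp p F + ε < F ω then 1 else 0) ≤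
      Real.exp (-2 * ε ^ 2 / (Fintype.card ι * c ^ 2)) := by
  set V := Fintype.card ι * c ^ 2 with hV
  have hmgf : ∀ s : ℝ, bernExp p (fun ω => Real.exp (s * F ω)) ≤
      Real.exp (s * bernExp p F + s ^ 2 * V / 8) := by
    intro s
    let e := Fintype.equivFin ι
    have h1 := bernExp_exp_le (p := p ∘ e.symm) (fun k => hp _) (c := c)
      (F := fun ω => F (ω ∘ e)) (fun ω k b => by
        rw [Function.update_comp_equiv]
        exact hF _ _ _) s
    rw [← bernExp_congr_equiv e.symm, ← bernExp_congr_equiv e.symm] at h1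
    simpa [Function.comp_assoc] using h1
  -- The minimizer of the Chernoff exponent `-s * ε + s ^ 2 * V / 8`, with minimum `-2 * ε ^ 2 / V`.
  set s := 4 * ε / V with hs
  have hs0 : 0 ≤ s := by positivity
  calc _ ≤ bernExp p (fun ω => Real.exp (-(s * (bernExp p F + ε))) * Real.exp (s * F ω)) := by
        refine bernExp_mono hp fun ω => ?_
        split_ifs with h
        · rw [← Real.exp_add, Real.one_le_exp_iff]
          nlinarith
        · positivity
    _ ≤ Real.exp (-(s * (bernExp p F + ε))) * Real.exp (s * bernExp p F + s ^ 2 * V / 8) := by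
        rw [bernExp_const_mul]
        gcongr
        exact hmgf s
    _ = _ := by
        rw [← Real.exp_add]
        congr 1
        rw [hs]
        field_simp
        ring

/-! ### Comparison of Bernoulli and Rademacher processes -/

/-- One Bernoulli coordinate in the supremum of a process is dominated by a Rademacher coordinate,
if its coefficient varies no more than that of the latter. -/
lemma iSup_bernoulli_le_rademacher {K : Type*} [Nonempty K] {A h t : K → ℝ} {p CA Ch Ct : ℝ}
    (hp : p ∈ Set.Icc (0 : ℝ) 1) (hA : ∀ a, |A a| ≤ CA) (hh : ∀ a, |h a| ≤ Ch)
    (ht : ∀ a, |t a| ≤ Ct) (hht : ∀ a b, |h a - h b| ≤ |t a - t b|) :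
    (1 - p) * (⨆ a, (A a + h a * p)) + p * (⨆ a, (A a + h a * (p - 1))) ≤
      (1 - 1 / 2) * (⨆ a, (A a + t a * (-1))) + 1 / 2 * (⨆ a, (A a + t a * 1)) := by
  obtain ⟨hp0, hp1⟩ := hp
  have hbdd : ∀ (f : K → ℝ) (C : ℝ), (∀ a, |f a| ≤ C) → ∀ r : ℝ, |r| ≤ 1 →
      BddAbove (Set.range fun a => A a + f a * r) := by
    intro f C hf r hr
    refine ⟨CA + C, ?_⟩
    rintro _ ⟨a, rfl⟩
    have h1 : |f a * r| ≤ C := by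
      rw [abs_mul]
      exact (mul_le_of_le_one_right (abs_nonneg _) hr).trans (hf a)
    linarith [le_abs_self (A a), le_abs_self (f a * r), hA a]
  set S₁ := ⨆ a, (A a + h a * 1)
  set S₂ := ⨆ a, (A a + h a * (-1))
  set R₁ := ⨆ a, (A a + t a * 1)
  set R₂ := ⨆ a, (A a + t a * (-1))
  have hS₁ : ∀ a, A a + h a ≤ S₁ := fun a => by
    have := le_ciSup (hbdd h Ch hh 1 (by simp)) a
    linarith
  have hS₂ : ∀ a, A a - h a ≤ S₂ := fun a => by
    have := le_ciSup (hbdd h Ch hh (-1) (by simp)) a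
    linarith
  have hR₁ : ∀ a, A a + t a ≤ R₁ := fun a => by
    have := le_ciSup (hbdd t Ct ht 1 (by simp)) a
    linarith
  have hR₂ : ∀ a, A a - t a ≤ R₂ := fun a => by
    have := le_ciSup (hbdd t Ct ht (-1) (by simp)) a
    linarith
  -- By convexity: `p` and `p - 1` are mixtures of `1` and `-1`. Averaged with weights `1 - p` and
  -- `p`, these two bounds give exactly `(S₁ + S₂) / 2`.
  have h1 : (⨆ a, (A a + h a * p)) ≤ (1 + p) / 2 * S₁ + (1 - p) / 2 * S₂ :=
    ciSup_le fun a => by nlinarith [hS₁ a, hS₂ a]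
  have h2 : (⨆ a, (A a + h a * (p - 1))) ≤ p / 2 * S₁ + (2 - p) / 2 * S₂ :=
    ciSup_le fun a => by nlinarith [hS₁ a, hS₂ a]
  -- Contraction: `S₁ + S₂` is the supremum over pairs of `A a + A b + h a - h b`. Replacing `h a -
  -- h b` by `|t a - t b|` costs nothing, as swapping `a` and `b` realizes either sign.
  have h3 : S₁ + S₂ ≤ R₁ + R₂ := by
    have h4 : ∀ b, S₁ ≤ R₁ + R₂ - (A b - h b) := by
      intro b
      refine ciSup_le fun a => ?_
      have h5 := (le_abs_self _).trans (hht a b)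
      rcases abs_cases (t a - t b) with h6 | h6 <;>
        linarith [hR₁ a, hR₂ b, hR₁ b, hR₂ a]
    have h5 : S₂ ≤ R₁ + R₂ - S₁ := ciSup_le fun b => by linarith [h4 b]
    linarith
  have h7 := mul_le_mul_of_nonneg_left h1 (by linarith : 0 ≤ 1 - p)
  have h8 := mul_le_mul_of_nonneg_left h2 hp0
  linarith

/-- The sign `±1` encoded by a Boolean. -/
def boolSign (b : Bool) : ℝ := if b then 1 else -1

/-- The centred Bernoulli variable `p - b`. -/
def centred (p : ℝ) (b : Bool) : ℝ := if b then p - 1 else p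

lemma abs_boolSign (b : Bool) : |boolSign b| = 1 := by cases b <;> simp [boolSign]

lemma abs_centred_le {p : ℝ} (hp : p ∈ Set.Icc (0 : ℝ) 1) (b : Bool) : |centred p b| ≤ 1 := by
  obtain ⟨h0, h1⟩ := hp
  cases b <;> simp only [centred, abs_le] <;> constructor <;> simp <;> linarith

/-- The offset `A` makes the induction close: it absorbs the first coordinate while the others are
exchanged, and then the exchanged ones while the first is treated. The bound `CA` only keeps the
suprema finite. -/
lemma bernExp_iSup_le_fin {N : ℕ} {K : Type*} [Nonempty K] {p : Fin N → ℝ}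
    (hp : ∀ k, p k ∈ Set.Icc (0 : ℝ) 1) {A : K → ℝ} {h t : Fin N → K → ℝ} {CA C : ℝ}
    (hA : ∀ a, |A a| ≤ CA) (hh : ∀ k a, |h k a| ≤ C) (ht : ∀ k a, |t k a| ≤ C)
    (hht : ∀ k a b, |h k a - h k b| ≤ |t k a - t k b|) :
    bernExp p (fun ω => ⨆ a, (A a + ∑ k, h k a * centred (p k) (ω k))) ≤
      bernExp (fun _ => 1 / 2) (fun ω => ⨆ a, (A a + ∑ k, t k a * boolSign (ω k))) := by
  have half : (1 / 2 : ℝ) ∈ Set.Icc (0 : ℝ) 1 := by constructor <;> norm_num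
  induction N generalizing A CA with
  | zero => simp [bernExp_zero]
  | succ N ih =>
    have hp0 := hp 0
    have key : ∀ b : Bool,
        bernExp (fun k : Fin N => p k.succ) (fun ω => ⨆ a, (A a + ∑ k : Fin (N + 1),
          h k a * centred (p k) ((Fin.cons b ω : Fin (N + 1) → Bool) k))) ≤
        bernExp (fun _ => 1 / 2) (fun ω : Fin N → Bool => ⨆ a,
          ((A a + ∑ k : Fin N, t k.succ a * boolSign (ω k)) + h 0 a * centred (p 0) b)) := by
      intro b
      have := ih (p := fun k => p k.succ) (fun k => hp _) (A := fun a => A a + h 0 a * centred (p 0) b)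
        (h := fun k => h k.succ) (t := fun k => t k.succ) (CA := CA + C) (fun a => ?_)
        (fun k => hh _) (fun k => ht _) (fun k => hht _)
      · simp only [Fin.sum_univ_succ, Fin.cons_zero, Fin.cons_succ, ← add_assoc]
        simpa only [add_right_comm] using this
      · refine (abs_add_le _ _).trans (add_le_add (hA a) ?_)
        rw [abs_mul]
        exact (mul_le_of_le_one_right (abs_nonneg _) (abs_centred_le hp0 b)).trans (hh 0 a)
    rw [bernExp_succ, bernExp_succ]
    refine (add_le_add (mul_le_mul_of_nonneg_left (key false) (by linarith [hp0.2]))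
      (mul_le_mul_of_nonneg_left (key true) hp0.1)).trans ?_
    rw [← bernExp_const_mul, ← bernExp_const_mul, ← bernExp_add, ← bernExp_const_mul,
      ← bernExp_const_mul, ← bernExp_add]
    refine bernExp_mono (fun _ => half) fun ω => ?_
    have := iSup_bernoulli_le_rademacher (K := K)
      (A := fun a => A a + ∑ k : Fin N, t k.succ a * boolSign (ω k))
      (CA := CA + N * C) hp0 (fun a => ?_) (hh 0) (ht 0) (hht 0)
    · simp only [Fin.sum_univ_succ, Fin.cons_zero, Fin.cons_succ, ← add_assoc]
      simp only [add_right_comm (A _) (t 0 _ * _)]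
      simpa [centred, boolSign] using this
    · refine (abs_add_le _ _).trans (add_le_add (hA a) ?_)
      refine (Finset.abs_sum_le_sum_abs _ _).trans ?_
      refine (Finset.sum_le_card_nsmul _ _ C fun k _ => ?_).trans (by simp)
      rw [abs_mul, abs_boolSign, mul_one]
      exact ht _ _

/-- Comparison of a Bernoulli process with a Rademacher process whose coefficients vary more. -/
lemma bernExp_iSup_le {ι : Type*} [Fintype ι] [DecidableEq ι] {K : Type*} [Nonempty K] {p : ι → ℝ}
    (hp : ∀ k, p k ∈ Set.Icc (0 : ℝ) 1) {h t : ι → K → ℝ} {C : ℝ}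
    (hh : ∀ k a, |h k a| ≤ C) (ht : ∀ k a, |t k a| ≤ C)
    (hht : ∀ k a b, |h k a - h k b| ≤ |t k a - t k b|) :
    bernExp p (fun ω => ⨆ a, ∑ k, h k a * centred (p k) (ω k)) ≤
      bernExp (fun _ => 1 / 2) (fun ω => ⨆ a, ∑ k, t k a * boolSign (ω k)) := by
  let e := Fintype.equivFin ι
  have := bernExp_iSup_le_fin (K := K) (p := p ∘ e.symm) (fun k => hp _) (A := fun _ => 0)
    (h := fun k => h (e.symm k)) (t := fun k => t (e.symm k)) (CA := 0) (C := C) (by simp)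
    (fun k => hh _) (fun k => ht _) (fun k => hht _)
  have hconst : (fun _ : Fin (Fintype.card ι) => (1 / 2 : ℝ)) = (fun _ : ι => (1 / 2 : ℝ)) ∘ e.symm :=
    rfl
  rw [hconst, ← bernExp_congr_equiv, ← bernExp_congr_equiv] at this
  simp only [zero_add, Function.comp_apply] at this
  have h1 : ∀ (f : K → ι → ℝ) a, ∑ k, f a (e.symm k) = ∑ k, f a k := fun f a => e.symm.sum_comp _
  have h2 := fun ω : ι → Bool => h1 (fun a k => h k a * centred (p k) (ω k))
  have h3 := fun ω : ι → Bool => h1 (fun a k => t k a * boolSign (ω k))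
  simpa only [h2, h3] using this

/-! ### Nets of Euclidean balls and the operator norm -/

lemma sum_Icc_half_pow_natAbs_le (b : ℕ) :
    ∑ z ∈ Finset.Icc (-(b : ℤ)) b, (1 / 2 : ℝ) ^ z.natAbs ≤ 3 := by
  have h : ∑ z ∈ Finset.Icc (-(b : ℤ)) b, (1 / 2 : ℝ) ^ z.natAbs = 3 - 2 * (1 / 2 : ℝ) ^ b := by
    induction b with
    | zero => norm_num
    | succ b ih =>
      have h1 : Finset.Icc (-((b + 1 : ℕ) : ℤ)) ((b + 1 : ℕ) : ℤ) =
          insert (-((b + 1 : ℕ) : ℤ)) (insert ((b + 1 : ℕ) : ℤ) (Finset.Icc (-(b : ℤ)) b)) := by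
        ext z
        simp only [Finset.mem_insert, Finset.mem_Icc]
        omega
      have h2 : ((b + 1 : ℕ) : ℤ) ∉ Finset.Icc (-(b : ℤ)) b := by
        simp only [Finset.mem_Icc]
        omega
      have h3 : -((b + 1 : ℕ) : ℤ) ∉ insert ((b + 1 : ℕ) : ℤ) (Finset.Icc (-(b : ℤ)) b) := by
        simp only [Finset.mem_insert, Finset.mem_Icc]
        omega
      rw [h1, Finset.sum_insert h3, Finset.sum_insert h2, ih, Int.natAbs_neg, Int.natAbs_natCast,
        pow_succ]
      ring
  rw [h]
  have : (0 : ℝ) < (1 / 2) ^ b := by positivity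
  linarith

/-- There are at most `384 ^ k` points of `ℤ ^ k` in the ball of radius `√(7 k)`. -/
lemma card_lattice_points_le (k : ℕ) (s : Finset (Fin k → ℤ))
    (hs : ∀ z ∈ s, ∑ i, z i ^ 2 ≤ 7 * (k : ℤ)) : (s.card : ℝ) ≤ 384 ^ k := by
  set box : Finset (Fin k → ℤ) :=
    Fintype.piFinset fun _ => Finset.Icc (-((7 * k : ℕ) : ℤ)) ((7 * k : ℕ) : ℤ) with hbox
  have hsub : s ⊆ box := by
    intro z hz
    rw [hbox, Fintype.mem_piFinset]
    intro i
    have h1 : z i ^ 2 ≤ 7 * (k : ℤ) :=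
      (Finset.single_le_sum (f := fun i => z i ^ 2) (fun i _ => sq_nonneg _)
        (Finset.mem_univ i)).trans (hs z hz)
    rw [Finset.mem_Icc]
    push_cast
    constructor <;> nlinarith
  -- Integers satisfy `|z i| ≤ z i ^ 2`, so the `ℓ¹` norm on `s` is at most `7 * k`. The weight then
  -- factors over coordinates, each contributing `2 ^ 7 * 3 = 384`.
  have hone : ∀ z ∈ s, (1 : ℝ) ≤ 2 ^ (7 * k) * ∏ i, (1 / 2 : ℝ) ^ (z i).natAbs := by
    intro z hz
    have h1 : ∑ i, (z i).natAbs ≤ 7 * k := by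
      zify
      refine le_trans (Finset.sum_le_sum fun i _ => ?_) (hs z hz)
      rw [← sq_abs]
      exact Int.le_self_sq _
    rw [Finset.prod_pow_eq_pow_sum, one_div, inv_pow, ← div_eq_mul_inv, one_le_div (by positivity)]
    exact pow_le_pow_right₀ one_le_two h1
  calc (s.card : ℝ) = ∑ z ∈ s, (1 : ℝ) := by simp
    _ ≤ ∑ z ∈ s, 2 ^ (7 * k) * ∏ i, (1 / 2 : ℝ) ^ (z i).natAbs := Finset.sum_le_sum hone
    _ ≤ ∑ z ∈ box, 2 ^ (7 * k) * ∏ i, (1 / 2 : ℝ) ^ (z i).natAbs :=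
        Finset.sum_le_sum_of_subset_of_nonneg hsub fun _ _ _ => by positivity
    _ = 2 ^ (7 * k) * ∏ _i : Fin k, ∑ z ∈ Finset.Icc (-((7 * k : ℕ) : ℤ)) ((7 * k : ℕ) : ℤ),
          (1 / 2 : ℝ) ^ z.natAbs := by
        rw [← Finset.mul_sum, Finset.prod_univ_sum]
    _ ≤ 2 ^ (7 * k) * ∏ _i : Fin k, 3 := by
        gcongr
        exact sum_Icc_half_pow_natAbs_le _
    _ = 384 ^ k := by
        rw [Finset.prod_const, Finset.card_univ, Fintype.card_fin, pow_mul, ← mul_pow]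
        norm_num

/-- A `1/4`-net of the unit ball of `ℝ ^ k` with at most `384 ^ k` points. -/
lemma exists_net_unitBall {k : ℕ} (hk : 0 < k) :
    ∃ s : Finset (EuclideanSpace ℝ (Fin k)), (s.card : ℝ) ≤ 384 ^ k ∧ (∀ u ∈ s, ‖u‖ ≤ 2) ∧
      ∀ x : EuclideanSpace ℝ (Fin k), ‖x‖ ≤ 1 → ∃ u ∈ s, ‖x - u‖ ≤ 1 / 4 := by
  classical
  have hk' : (0 : ℝ) < k := by exact_mod_cast hk
  -- The net is the lattice of mesh `1 / r`: rounding `r * x` moves each coordinate by at most `1 /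
  -- 2`, hence `x` by at most `√k / (2 * r) = 1 / 4`. The rounded point has squared norm at most `(5
  -- / 4) ^ 2 ≤ 7 / 4`, which is the `7 * k` below.
  set r : ℝ := 2 * √k with hr
  have hr0 : 0 < r := by positivity
  have hr2 : r ^ 2 = 4 * k := by
    rw [hr, mul_pow, Real.sq_sqrt hk'.le]
    norm_num
  let f : (Fin k → ℤ) → EuclideanSpace ℝ (Fin k) := fun z => WithLp.toLp 2 fun i => (z i : ℝ) / r
  have hf : ∀ z, ‖f z‖ ^ 2 = (∑ i, (z i : ℝ) ^ 2) / (4 * k) := by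
    intro z
    rw [EuclideanSpace.real_norm_sq_eq, Finset.sum_div]
    exact Finset.sum_congr rfl fun i _ => by simp only [f, div_pow, hr2]
  set box : Finset (Fin k → ℤ) :=
    (Fintype.piFinset fun _ => Finset.Icc (-((7 * k : ℕ) : ℤ)) ((7 * k : ℕ) : ℤ)).filter
      fun z => ∑ i, z i ^ 2 ≤ 7 * (k : ℤ) with hbox
  refine ⟨box.image f, ?_, ?_, ?_⟩
  · refine le_trans (Nat.cast_le.2 Finset.card_image_le) (card_lattice_points_le k box ?_)
    exact fun z hz => (Finset.mem_filter.1 hz).2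
  · intro u hu
    obtain ⟨z, hz, rfl⟩ := Finset.mem_image.1 hu
    have h1 : (∑ i, (z i : ℝ) ^ 2) ≤ 7 * k := by exact_mod_cast (Finset.mem_filter.1 hz).2
    refine le_of_sq_le_sq ?_ zero_le_two
    rw [hf, div_le_iff₀ (by positivity)]
    linarith
  · intro x hx
    let z : Fin k → ℤ := fun i => round (r * x i)
    have hd : ‖x - f z‖ ≤ 1 / 4 := by
      refine le_of_sq_le_sq ?_ (by norm_num)
      rw [EuclideanSpace.real_norm_sq_eq]
      calc ∑ i, (x - f z) i ^ 2 ≤ ∑ _i : Fin k, (1 / 4) / (4 * (k : ℝ)) := by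
            refine Finset.sum_le_sum fun i _ => ?_
            have h1 : (x - f z) i = (r * x i - round (r * x i)) / r := by
              simp only [f, z, PiLp.sub_apply]
              field_simp
            rw [h1, div_pow, hr2]
            gcongr
            have h2 := abs_sub_round (r * x i)
            rw [← sq_abs]
            nlinarith [abs_nonneg (r * x i - round (r * x i))]
        _ = (1 / 4) ^ 2 := by
            rw [Finset.sum_const, Finset.card_univ, Fintype.card_fin, nsmul_eq_mul]
            field_simp
    refine ⟨f z, Finset.mem_image_of_mem _ ?_, hd⟩
    have hn : ‖f z‖ ≤ 5 / 4 := by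
      have := norm_sub_le x (x - f z)
      rw [sub_sub_cancel] at this
      linarith
    have h3 : (∑ i, (z i : ℝ) ^ 2) ≤ 7 * k := by
      have h4 := hf z
      rw [eq_div_iff (by positivity)] at h4
      have h6 : ‖f z‖ ^ 2 ≤ 7 / 4 := by nlinarith [norm_nonneg (f z)]
      nlinarith
    have h5 : ∑ i, z i ^ 2 ≤ 7 * (k : ℤ) := by exact_mod_cast h3
    rw [hbox, Finset.mem_filter, Fintype.mem_piFinset]
    refine ⟨fun i => ?_, h5⟩
    have h6 := (Finset.single_le_sum (f := fun i => z i ^ 2) (fun i _ => sq_nonneg _)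
        (Finset.mem_univ i)).trans h5
    rw [Finset.mem_Icc]
    push_cast
    constructor <;> nlinarith

/-- The operator norm is attained, up to a factor `4`, on `1/4`-nets of the unit balls. -/
lemma exists_net_opNorm_le {E F : Type*} [NormedAddCommGroup E] [InnerProductSpace ℝ E]
    [NormedAddCommGroup F] [InnerProductSpace ℝ F] (M : E →L[ℝ] F) {s : Finset F} {s' : Finset E}
    (hs2 : ∀ u ∈ s, ‖u‖ ≤ 2) (hs : ∀ x : F, ‖x‖ ≤ 1 → ∃ u ∈ s, ‖x - u‖ ≤ 1 / 4)
    (hs' : ∀ x : E, ‖x‖ ≤ 1 → ∃ u ∈ s', ‖x - u‖ ≤ 1 / 4) :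
    ∃ u ∈ s, ∃ v ∈ s', ‖M‖ ≤ 4 * inner ℝ u (M v) := by
  obtain ⟨u₀, hu₀, -⟩ := hs 0 (by simp)
  obtain ⟨v₀, hv₀, -⟩ := hs' 0 (by simp)
  obtain ⟨⟨u, v⟩, huv, hmax⟩ := (s ×ˢ s').exists_max_image
    (fun q => (inner ℝ q.1 (M q.2) : ℝ)) ⟨(u₀, v₀), Finset.mk_mem_product hu₀ hv₀⟩
  obtain ⟨hu, hv⟩ := Finset.mem_product.1 huv
  refine ⟨u, hu, v, hv, ?_⟩
  set a : ℝ := inner ℝ u (M v)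
  -- Moving `x` to the net costs `‖M‖ / 4`; moving `y` costs `2 * ‖M‖ / 4`, since net points are
  -- only known to have norm at most `2`.
  have key : ∀ (x : F) (y : E), ‖x‖ ≤ 1 → ‖y‖ ≤ 1 → inner ℝ x (M y) ≤ a + 3 / 4 * ‖M‖ := by
    intro x y hx hy
    obtain ⟨x', hx', hxx⟩ := hs x hx
    obtain ⟨y', hy', hyy⟩ := hs' y hy
    have h1 : inner ℝ x' (M y') ≤ a := hmax (x', y') (Finset.mk_mem_product hx' hy')
    have h2 : inner ℝ (x - x') (M y) ≤ 1 / 4 * ‖M‖ := by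
      refine (real_inner_le_norm _ _).trans ?_
      refine mul_le_mul hxx ?_ (norm_nonneg _) (by norm_num)
      exact (M.le_opNorm y).trans (mul_le_of_le_one_right (norm_nonneg _) hy)
    have h3 : inner ℝ x' (M (y - y')) ≤ 2 * (‖M‖ * (1 / 4)) := by
      refine (real_inner_le_norm _ _).trans ?_
      refine mul_le_mul (hs2 _ hx') ?_ (norm_nonneg _) (by norm_num)
      exact (M.le_opNorm _).trans (mul_le_mul_of_nonneg_left hyy (norm_nonneg _))
    have h4 : (inner ℝ x (M y) : ℝ) =
        inner ℝ x' (M y') + inner ℝ (x - x') (M y) + inner ℝ x' (M (y - y')) := by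
      rw [map_sub, inner_sub_left, inner_sub_right]
      ring
    linarith
  have h0 : 0 ≤ a + 3 / 4 * ‖M‖ := by simpa using key 0 0 (by simp) (by simp)
  have h5 : ‖M‖ ≤ a + 3 / 4 * ‖M‖ := by
    refine M.opNorm_le_of_unit_norm h0 fun y hy => ?_
    by_cases hMy : M y = 0
    · simpa [hMy] using h0
    have h6 := key (‖M y‖⁻¹ • M y) y (by
      rw [norm_smul, norm_inv, norm_norm, inv_mul_cancel₀ (norm_ne_zero_iff.2 hMy)]) hy.le
    rw [real_inner_smul_left, real_inner_self_eq_norm_sq, sq, ← mul_assoc,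
      inv_mul_cancel₀ (norm_ne_zero_iff.2 hMy), one_mul] at h6
    exact h6
  linarith

/-! ### Duality of trace norm and operator norm -/

/-- The operator norm of a real matrix with respect to the Euclidean norms. -/
noncomputable def euclideanOpNorm {n m : ℕ} (A : Matrix (Fin n) (Fin m) ℝ) : ℝ :=
  ‖(Matrix.toEuclideanLin A).toContinuousLinearMap‖

lemma traceNorm_eq_sum {n m : ℕ} (A : Matrix (Fin n) (Fin m) ℝ) :
    traceNorm A = ∑ k : Fin m, (Matrix.toEuclideanLin A).singularValues k := by
  rw [traceNorm, Finsupp.sum_of_support_subset _ (s := Finset.range m) _ _ (by simp),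
    Finset.sum_range]
  intro k hk
  rw [Finset.mem_range]
  by_contra h
  exact Finsupp.mem_support_iff.1 hk
    (LinearMap.singularValues_of_finrank_le _ (by simpa using h))

lemma toEuclideanLin_apply_eq_inner {n m : ℕ} (C : Matrix (Fin n) (Fin m) ℝ)
    (x : EuclideanSpace ℝ (Fin m)) (i : Fin n) :
    (Matrix.toEuclideanLin C x) i =
      inner ℝ (WithLp.toLp 2 (C i) : EuclideanSpace ℝ (Fin m)) x := by
  simp [Matrix.toEuclideanLin, Matrix.mulVec, dotProduct, PiLp.inner_apply, mul_comm]

/-- The duality between the trace norm and the operator norm. -/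
lemma sum_mul_le_traceNorm_mul {n m : ℕ} (A B : Matrix (Fin n) (Fin m) ℝ) :
    ∑ i, ∑ j, A i j * B i j ≤ traceNorm A * euclideanOpNorm B := by
  set TA := Matrix.toEuclideanLin A with hTA
  set TB := Matrix.toEuclideanLin B with hTB
  have hfin : Module.finrank ℝ (EuclideanSpace ℝ (Fin m)) = m := by simp
  -- Right singular vectors of `A`: in this basis the pairing becomes `∑ k, ⟪A (v k), B (v k)⟫`, and
  -- `‖A (v k)‖` is the `k`-th singular value.
  set v := TA.isSymmetric_adjoint_comp_self.eigenvectorBasis hfin with hv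
  have htrace : ∑ i, ∑ j, A i j * B i j = ∑ k, inner ℝ (TA (v k)) (TB (v k)) := by
    have h1 : ∀ k, inner ℝ (TA (v k)) (TB (v k)) =
        ∑ i, inner ℝ (WithLp.toLp 2 (B i) : EuclideanSpace ℝ (Fin m)) (v k) *
          inner ℝ (v k) (WithLp.toLp 2 (A i) : EuclideanSpace ℝ (Fin m)) := by
      intro k
      rw [PiLp.inner_apply]
      refine Finset.sum_congr rfl fun i _ => ?_
      rw [hTA, hTB, toEuclideanLin_apply_eq_inner, toEuclideanLin_apply_eq_inner,
        real_inner_comm (WithLp.toLp 2 (A i))]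
      rfl
    simp only [h1]
    symm
    rw [Finset.sum_comm]
    refine Finset.sum_congr rfl fun i _ => ?_
    rw [v.sum_inner_mul_inner, PiLp.inner_apply]
    rfl
  have hnorm : ∀ k, ‖TA (v k)‖ = TA.singularValues k := by
    intro k
    refine (sq_eq_sq₀ (norm_nonneg _) (TA.singularValues_nonneg _)).1 ?_
    rw [TA.sq_singularValues_fin hfin, ← real_inner_self_eq_norm_sq, ← LinearMap.adjoint_inner_right,
      ← LinearMap.comp_apply, hv, LinearMap.IsSymmetric.apply_eigenvectorBasis]
    simp [real_inner_smul_right]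
  rw [htrace, traceNorm_eq_sum, Finset.sum_mul]
  refine Finset.sum_le_sum fun k _ => (real_inner_le_norm _ _).trans ?_
  rw [hnorm]
  refine mul_le_mul_of_nonneg_left ?_ (TA.singularValues_nonneg _)
  have h2 := (TB.toContinuousLinearMap).le_opNorm (v k)
  rw [v.norm_eq_one, mul_one] at h2
  exact h2

/-! ### Expected operator norm of a sum of sign matrices -/

/-- The sum of `T` random sign matrices of size `n × m`. -/
def signSum {n m T : ℕ} (ω : Fin T × Fin n × Fin m → Bool) : Matrix (Fin n) (Fin m) ℝ :=
  Matrix.of fun i j => ∑ t, boolSign (ω (t, i, j))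

/-- For fixed net vectors the bilinear form is a Rademacher sum, hence sub-Gaussian. Summing
exponential moments over all pairs of the two nets costs a factor `exp (12 * m)`, where `n ≤ m` is
used, and Jensen turns `exp (140 * m)` into the bound `140 * m / r`. -/
lemma bernExp_euclideanOpNorm_signSum_le {n m T : ℕ} (hn : 0 < n) (hnm : n ≤ m) (hT : 0 < T) :
    bernExp (fun _ => 1 / 2) (fun ω : Fin T × Fin n × Fin m → Bool => euclideanOpNorm (signSum ω)) ≤
      140 * √(m * T) := by
  have half : ∀ _ : Fin T × Fin n × Fin m, (1 / 2 : ℝ) ∈ Set.Icc (0 : ℝ) 1 := fun _ => by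
    constructor <;> norm_num
  have hm : 0 < m := hn.trans_le hnm
  obtain ⟨s, hsc, hs2, hs⟩ := exists_net_unitBall hn
  obtain ⟨s', hsc', hs2', hs'⟩ := exists_net_unitBall hm
  have hm' : (0 : ℝ) < m := by exact_mod_cast hm
  have hT' : (0 : ℝ) < T := by exact_mod_cast hT
  -- This scale makes the sub-Gaussian exponent, of order `r ^ 2 * T`, comparable to the
  -- log-cardinality of the nets, of order `m`.
  set r : ℝ := √(m / T) with hr
  have hr0 : 0 < r := by positivity
  have hr2 : r ^ 2 = m / T := Real.sq_sqrt (by positivity)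
  have hinner : ∀ (ω : Fin T × Fin n × Fin m → Bool) (u : EuclideanSpace ℝ (Fin n))
      (v : EuclideanSpace ℝ (Fin m)),
      inner ℝ u (Matrix.toEuclideanLin (signSum ω) v) =
        ∑ k : Fin T × Fin n × Fin m, u k.2.1 * v k.2.2 * boolSign (ω k) := by
    intro ω u v
    simp only [PiLp.inner_apply, RCLike.inner_apply, conj_trivial, toEuclideanLin_apply_eq_inner,
      signSum, Matrix.of_apply, Fintype.sum_prod_type]
    rw [Finset.sum_comm]
    refine Finset.sum_congr rfl fun i _ => ?_
    rw [Finset.sum_comm, Finset.sum_mul]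
    refine Finset.sum_congr rfl fun j _ => ?_
    rw [Finset.mul_sum, Finset.sum_mul]
    exact Finset.sum_congr rfl fun t _ => by ring
  have hmgf : ∀ u ∈ s, ∀ v ∈ s', bernExp (fun _ => 1 / 2)
      (fun ω : Fin T × Fin n × Fin m → Bool =>
        Real.exp (4 * r * inner ℝ u (Matrix.toEuclideanLin (signSum ω) v))) ≤
      Real.exp (128 * m) := by
    intro u hu v hv
    simp only [hinner, Finset.mul_sum, Real.exp_sum]
    rw [bernExp_prod fun (k : Fin T × Fin n × Fin m) b =>
      Real.exp (4 * r * (u k.2.1 * v k.2.2 * boolSign b))]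
    -- Each sign averages to a `cosh`, bounded by `exp (x ^ 2 / 2)`. With `‖u‖, ‖v‖ ≤ 2` the
    -- exponent is at most `8 * r ^ 2 * T * 16 = 128 * m`.
    calc _ ≤ ∏ k : Fin T × Fin n × Fin m, Real.exp ((4 * r * (u k.2.1 * v k.2.2)) ^ 2 / 2) := by
          refine Finset.prod_le_prod (fun k _ => by positivity) fun k _ => ?_
          refine le_trans (le_of_eq ?_) (Real.cosh_le_exp_half_sq _)
          rw [Real.cosh_eq]
          simp only [boolSign]
          simp
          ring_nf
      _ = Real.exp (8 * r ^ 2 * (T * ((∑ i, u i ^ 2) * ∑ j, v j ^ 2))) := by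
          rw [← Real.exp_sum]
          congr 1
          rw [Finset.sum_mul_sum]
          simp only [Fintype.sum_prod_type, Finset.sum_const, Finset.card_univ, Fintype.card_fin,
            nsmul_eq_mul, Finset.mul_sum]
          exact Finset.sum_congr rfl fun i _ => Finset.sum_congr rfl fun j _ => by ring
      _ ≤ _ := by
          rw [← EuclideanSpace.real_norm_sq_eq, ← EuclideanSpace.real_norm_sq_eq, hr2]
          apply Real.exp_le_exp.2
          have h1 : ‖u‖ ^ 2 ≤ 4 := by nlinarith [hs2 u hu, norm_nonneg u]
          have h2 : ‖v‖ ^ 2 ≤ 4 := by nlinarith [hs2' v hv, norm_nonneg v]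
          have h3 : ‖u‖ ^ 2 * ‖v‖ ^ 2 ≤ 4 * 4 := by gcongr
          calc _ = 8 * m * (‖u‖ ^ 2 * ‖v‖ ^ 2) := by field_simp
            _ ≤ 8 * m * (4 * 4) := by gcongr
            _ = _ := by ring
  -- Numerically, `384 ≤ 2.7 ^ 6`.
  have hcard : ∀ k : ℕ, (384 : ℝ) ^ k ≤ Real.exp (6 * k) := by
    intro k
    rw [mul_comm, Real.exp_nat_mul]
    have h1 : (2.7 : ℝ) ≤ Real.exp 1 := by linarith [Real.exp_one_gt_d9]
    have h2 : Real.exp 6 = Real.exp 1 ^ 6 := by rw [← Real.exp_nat_mul]; norm_num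
    rw [h2]
    gcongr
    exact le_trans (by norm_num) (pow_le_pow_left₀ (by norm_num) h1 6)
  have hexp : bernExp (fun _ => 1 / 2) (fun ω : Fin T × Fin n × Fin m → Bool =>
      Real.exp (r * euclideanOpNorm (signSum ω))) ≤ Real.exp (140 * m) := by
    calc _ ≤ bernExp (fun _ => 1 / 2) (fun ω : Fin T × Fin n × Fin m → Bool =>
          ∑ u ∈ s, ∑ v ∈ s', Real.exp (4 * r * inner ℝ u (Matrix.toEuclideanLin (signSum ω) v))) := by
          refine bernExp_mono half fun ω => ?_
          obtain ⟨u, hu, v, hv, huv⟩ := exists_net_opNorm_le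
            (Matrix.toEuclideanLin (signSum ω)).toContinuousLinearMap hs2 hs hs'
          calc _ ≤ Real.exp (4 * r * inner ℝ u (Matrix.toEuclideanLin (signSum ω) v)) := by
                apply Real.exp_le_exp.2
                rw [mul_comm 4 r, mul_assoc]
                exact mul_le_mul_of_nonneg_left huv hr0.le
            _ ≤ ∑ v ∈ s', Real.exp (4 * r * inner ℝ u (Matrix.toEuclideanLin (signSum ω) v)) :=
                Finset.single_le_sum (f := fun v => Real.exp (4 * r *
                  inner ℝ u (Matrix.toEuclideanLin (signSum ω) v))) (fun _ _ => by positivity) hv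
            _ ≤ _ := Finset.single_le_sum (f := fun u => ∑ v ∈ s', Real.exp (4 * r *
                  inner ℝ u (Matrix.toEuclideanLin (signSum ω) v))) (fun _ _ => by positivity) hu
      _ ≤ ∑ u ∈ s, ∑ v ∈ s', Real.exp (128 * m) := by
          rw [bernExp_sum]
          refine Finset.sum_le_sum fun u hu => ?_
          rw [bernExp_sum]
          exact Finset.sum_le_sum fun v hv => hmgf u hu v hv
      _ = s.card * (s'.card * Real.exp (128 * m)) := by simp
      _ ≤ Real.exp (6 * m) * (Real.exp (6 * m) * Real.exp (128 * m)) := by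
          have hnm' : (n : ℝ) ≤ m := by exact_mod_cast hnm
          have h1 : (s.card : ℝ) ≤ Real.exp (6 * m) :=
            (hsc.trans (hcard n)).trans (Real.exp_le_exp.2 (by linarith))
          have h2 := hsc'.trans (hcard m)
          gcongr
      _ = _ := by
          rw [← Real.exp_add, ← Real.exp_add]
          congr 1
          ring
  refine (bernExp_le_of_exp half hr0 hexp).trans (le_of_eq ?_)
  rw [div_eq_iff hr0.ne', mul_assoc, hr, ← Real.sqrt_mul (by positivity)]
  have h9 : (m : ℝ) * T * (m / T) = m ^ 2 := by field_simp
  rw [h9, Real.sqrt_sq hm'.le]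

/-! ### Uniform deviation of a Bernoulli process -/

lemma bddAbove_range_process {ι : Type*} [Fintype ι] {K : Type*} {p : ι → ℝ}
    (hp : ∀ k, p k ∈ Set.Icc (0 : ℝ) 1) {h : ι → K → ℝ} {c : ℝ} (hh : ∀ k a, |h k a| ≤ c)
    (ω : ι → Bool) : BddAbove (Set.range fun a => ∑ k, h k a * centred (p k) (ω k)) := by
  refine ⟨∑ _k : ι, c, ?_⟩
  rintro _ ⟨a, rfl⟩
  refine Finset.sum_le_sum fun k _ => (le_abs_self _).trans ?_
  rw [abs_mul]
  exact (mul_le_of_le_one_right (abs_nonneg _) (abs_centred_le (hp k) _)).trans (hh k a)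

/-- Only the `k`-th summand changes, and the two values `p - 1` and `p` of a centred variable differ
by `1`. This is the bounded difference needed for McDiarmid. -/
lemma iSup_process_update_le {ι : Type*} [Fintype ι] [DecidableEq ι] {K : Type*} [Nonempty K]
    {p : ι → ℝ} (hp : ∀ k, p k ∈ Set.Icc (0 : ℝ) 1) {h : ι → K → ℝ} {c : ℝ}
    (hh : ∀ k a, |h k a| ≤ c) (ω : ι → Bool) (k : ι) (b : Bool) :
    (⨆ a, ∑ j, h j a * centred (p j) (Function.update ω k b j)) ≤
      (⨆ a, ∑ j, h j a * centred (p j) (ω j)) + c := by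
  refine ciSup_le fun a => ?_
  have h1 := le_ciSup (bddAbove_range_process hp hh ω) a
  have h2 : ∑ j, h j a * centred (p j) (Function.update ω k b j) -
      ∑ j, h j a * centred (p j) (ω j) = h k a * (centred (p k) b - centred (p k) (ω k)) := by
    rw [← Finset.sum_sub_distrib, Finset.sum_eq_single k]
    · rw [Function.update_self]; ring
    · intro j _ hj
      rw [Function.update_of_ne hj, sub_self]
    · simp
  have h3 : |centred (p k) b - centred (p k) (ω k)| ≤ 1 := by
    cases b <;> cases ω k <;> simp [centred]
  have h4 : h k a * (centred (p k) b - centred (p k) (ω k)) ≤ c := by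
    refine (le_abs_self _).trans ?_
    rw [abs_mul]
    exact (mul_le_of_le_one_right (abs_nonneg _) h3).trans (hh k a)
  linarith

lemma abs_iSup_process_update_sub_le {ι : Type*} [Fintype ι] [DecidableEq ι] {K : Type*}
    [Nonempty K] {p : ι → ℝ} (hp : ∀ k, p k ∈ Set.Icc (0 : ℝ) 1) {h : ι → K → ℝ} {c : ℝ}
    (hh : ∀ k a, |h k a| ≤ c) (ω : ι → Bool) (k : ι) (b : Bool) :
    |(⨆ a, ∑ j, h j a * centred (p j) (Function.update ω k b j)) -
      (⨆ a, ∑ j, h j a * centred (p j) (ω j))| ≤ c := by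
  have h1 := iSup_process_update_le hp hh ω k b
  have h2 := iSup_process_update_le hp hh (Function.update ω k b) k (ω k)
  rw [Function.update_idem, Function.update_eq_self] at h2
  rw [abs_le]
  constructor <;> linarith

/-- A uniform one-sided deviation bound in terms of the Rademacher complexity. -/
lemma bernExp_exists_process_gt_le {ι : Type*} [Fintype ι] [DecidableEq ι] {K : Type*} [Nonempty K]
    {p : ι → ℝ} (hp : ∀ k, p k ∈ Set.Icc (0 : ℝ) 1) {h t : ι → K → ℝ} {c C : ℝ}
    (hc : 0 < Fintype.card ι * c ^ 2) (hcC : c ≤ C)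
    (hh : ∀ k a, |h k a| ≤ c) (ht : ∀ k a, |t k a| ≤ C)
    (hht : ∀ k a b, |h k a - h k b| ≤ |t k a - t k b|) {R ε : ℝ} (hε : 0 ≤ ε)
    (hR : bernExp (fun _ => 1 / 2) (fun ω => ⨆ a, ∑ k, t k a * boolSign (ω k)) ≤ R)
    [DecidablePred fun ω : ι → Bool => ∃ a, R + ε < ∑ k, h k a * centred (p k) (ω k)] :
    bernExp p (fun ω => if ∃ a, R + ε < ∑ k, h k a * centred (p k) (ω k) then 1 else 0) ≤
      Real.exp (-2 * ε ^ 2 / (Fintype.card ι * c ^ 2)) := by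
  refine le_trans (bernExp_mono hp fun ω => ?_)
    (bernExp_mcdiarmid
      (F := fun ω => ⨆ a, ∑ k, h k a * centred (p k) (ω k)) hp
      (abs_iSup_process_update_sub_le hp hh) hε hc)
  have hE := (bernExp_iSup_le hp (fun k a => (hh k a).trans hcC) ht hht).trans hR
  split_ifs with h1 h2 h2
  · exact le_rfl
  · obtain ⟨a, ha⟩ := h1
    exact absurd (ha.trans_le (le_ciSup (bddAbove_range_process hp hh ω) a))
      (by simp only [not_lt] at h2 ⊢; linarith)
  · exact zero_le_one
  · exact le_rfl

/-! ### The sample law and the losses in Boolean coordinates -/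

section sample

variable {n m T : ℕ}

/-- The sample of binary matrices encoded by Booleans. -/
def boolSample (ω : Fin T × Fin n × Fin m → Bool) : Fin T → UnitMatrix n m :=
  fun t i j => if ω (t, i, j) then 1 else 0

lemma boolSample_injective :
    Function.Injective (boolSample : (Fin T × Fin n × Fin m → Bool) → _) := by
  intro ω ω' h
  ext ⟨t, i, j⟩
  have := congr_fun (congr_fun (congr_fun h t) i) j
  simp only [boolSample] at this
  cases h1 : ω (t, i, j) <;> cases h2 : ω' (t, i, j) <;> simp_all

instance (p : UnitMatrix n m) : IsProbabilityMeasure (bernoulliMatrix p) := by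
  unfold bernoulliMatrix
  infer_instance

instance (p : UnitMatrix n m) : IsProbabilityMeasure (sampleLaw T p) := by
  unfold sampleLaw
  infer_instance

lemma bernoulliMeasure_real_singleton (p : I) (b : Bool) :
    (bernoulliMeasure (1 : I) 0 p).real {if b then 1 else 0} = bernWeight p b := by
  cases b
  · rw [bernoulliMeasure_real_apply_of_notMem_of_mem _ (measurableSet_singleton _)] <;>
      simp [bernWeight]
  · rw [bernoulliMeasure_real_apply_of_mem_of_notMem _ (measurableSet_singleton _)] <;>
      simp [bernWeight]

lemma sampleLaw_real_singleton (p : UnitMatrix n m) (ω : Fin T × Fin n × Fin m → Bool) :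
    (sampleLaw T p).real {boolSample ω} =
      ∏ k : Fin T × Fin n × Fin m, bernWeight (p k.2.1 k.2.2) (ω k) := by
  simp only [Measure.real, sampleLaw, Measure.pi_singleton, bernoulliMatrix, ENNReal.toReal_prod,
    Fintype.prod_prod_type]
  refine Finset.prod_congr rfl fun t _ => Finset.prod_congr rfl fun i _ =>
    Finset.prod_congr rfl fun j _ => ?_
  exact bernoulliMeasure_real_singleton _ _

-- The samples in `A` that come from Boolean arrays form a finite set of distinct atoms, whose
-- masses are the Bernoulli weights. Using only monotonicity, the inequality needs no measurability
-- of `A`.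
open Classical in
lemma bernExp_indicator_le_sampleLaw (p : UnitMatrix n m) (A : Set (Fin T → UnitMatrix n m)) :
    bernExp (fun k : Fin T × Fin n × Fin m => (p k.2.1 k.2.2 : ℝ))
      (fun ω => if boolSample ω ∈ A then 1 else 0) ≤ (sampleLaw T p).real A := by
  set s : Finset (Fin T → UnitMatrix n m) :=
    (Finset.univ.filter fun ω : Fin T × Fin n × Fin m → Bool => boolSample ω ∈ A).image boolSample
  have hs : (s : Set (Fin T → UnitMatrix n m)) ⊆ A := by
    intro S hS
    obtain ⟨ω, hω, rfl⟩ := Finset.mem_image.1 (Finset.mem_coe.1 hS)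
    exact (Finset.mem_filter.1 hω).2
  refine le_trans (le_of_eq ?_) (measureReal_mono hs)
  have : MeasurableSingletonClass (UnitMatrix n m) := Pi.instMeasurableSingletonClass
  rw [← sum_measureReal_singleton, Finset.sum_image boolSample_injective.injOn, Finset.sum_filter]
  refine Finset.sum_congr rfl fun ω _ => ?_
  rw [sampleLaw_real_singleton]
  by_cases hA : boolSample ω ∈ A <;> simp [hA]

lemma IsLipschitzLoss.measurable_right {L : ℝ} {loss : I → I → ℝ} (h : IsLipschitzLoss L loss)
    (hL : 0 ≤ L) (x : I) : Measurable (loss x) := by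
  have : LipschitzWith ⟨L, hL⟩ (loss x) := LipschitzWith.of_dist_le_mul fun y y' => by
    rw [Real.dist_eq, Subtype.dist_eq, Real.dist_eq]
    exact h.lipschitz_right x y y'
  exact this.continuous.measurable

lemma integral_bernoulliMatrix (p : UnitMatrix n m) (i : Fin n) (j : Fin m) {f : I → ℝ}
    (hf : Measurable f) :
    Integrable (fun Y : UnitMatrix n m => f (Y i j)) (bernoulliMatrix p) ∧
      ∫ Y, f (Y i j) ∂(bernoulliMatrix p) = p i j * f 1 + (1 - p i j) * f 0 := by
  have hmp : MeasurePreserving (fun Y : UnitMatrix n m => Y i j) (bernoulliMatrix p)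
      (bernoulliMeasure (1 : I) 0 (p i j)) :=
    (measurePreserving_eval (fun j => bernoulliMeasure (1 : I) 0 (p i j)) j).comp
      (measurePreserving_eval (fun i => Measure.pi fun j => bernoulliMeasure (1 : I) 0 (p i j)) i)
  constructor
  · exact hmp.integrable_comp_of_integrable (integrable_bernoulliMeasure _ _ _ f)
  · have h1 := integral_map hmp.measurable.aemeasurable
      (f := f) (μ := bernoulliMatrix p) hf.aestronglyMeasurable
    rw [← h1, hmp.map_eq, integral_bernoulliMeasure]
    simp

lemma trueLoss_bernoulliMatrix {L : ℝ} {loss : I → I → ℝ} (h : IsLipschitzLoss L loss)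
    (hL : 0 ≤ L) (X p : UnitMatrix n m) :
    trueLoss loss X (bernoulliMatrix p) = (1 / ((n : ℝ) * (m : ℝ))) *
      ∑ i, ∑ j, (p i j * loss (X i j) 1 + (1 - p i j) * loss (X i j) 0) := by
  have hint := fun i j => integral_bernoulliMatrix p i j (h.measurable_right hL (X i j))
  simp only [trueLoss, matrixLoss]
  rw [integral_const_mul, integral_finsetSum _ fun i _ =>
    integrable_finsetSum _ fun j _ => (hint i j).1]
  congr 1
  refine Finset.sum_congr rfl fun i _ => ?_
  rw [integral_finsetSum _ fun j _ => (hint i j).1]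
  exact Finset.sum_congr rfl fun j _ => (hint i j).2

/-- Entrywise, `p * l₁ + (1 - p) * l₀ - l_b = (l₁ - l₀) * (p - b)` for `b ∈ {0, 1}`: binary data
make every loss affine in the observation. -/
lemma trueLoss_sub_empiricalLoss {L : ℝ} {loss : I → I → ℝ} (h : IsLipschitzLoss L loss)
    (hL : 0 ≤ L) (hT : 0 < T) (X p : UnitMatrix n m) (ω : Fin T × Fin n × Fin m → Bool) :
    trueLoss loss X (bernoulliMatrix p) - empiricalLoss loss X (boolSample ω) =
      ∑ k : Fin T × Fin n × Fin m,
        (1 / ((n : ℝ) * m * T) * (loss (X k.2.1 k.2.2) 1 - loss (X k.2.1 k.2.2) 0)) *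
          centred (p k.2.1 k.2.2) (ω k) := by
  have hT' : (T : ℝ) ≠ 0 := by positivity
  have h1 : trueLoss loss X (bernoulliMatrix p) = (1 / (T : ℝ)) * ∑ _t : Fin T,
      trueLoss loss X (bernoulliMatrix p) := by
    rw [Finset.sum_const, Finset.card_univ, Fintype.card_fin, nsmul_eq_mul]
    field_simp
  rw [h1, empiricalLoss, ← mul_sub, ← Finset.sum_sub_distrib, Finset.mul_sum,
    Fintype.sum_prod_type]
  refine Finset.sum_congr rfl fun t _ => ?_
  rw [trueLoss_bernoulliMatrix h hL, matrixLoss, ← mul_sub, ← Finset.sum_sub_distrib, ← mul_assoc,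
    Finset.mul_sum, Fintype.sum_prod_type]
  refine Finset.sum_congr rfl fun i _ => ?_
  rw [← Finset.sum_sub_distrib, Finset.mul_sum]
  refine Finset.sum_congr rfl fun j _ => ?_
  have h2 : 1 / (T : ℝ) * (1 / ((n : ℝ) * m)) = 1 / ((n : ℝ) * m * T) := by
    rw [one_div_mul_one_div, mul_comm]
  rw [h2, mul_assoc (1 / ((n : ℝ) * m * T))]
  refine congrArg _ ?_
  cases hω : ω (t, i, j) <;> simp [boolSample, centred, hω] <;> ring

/-! ### Rademacher complexity of the ball and the final bound -/

/-- The Rademacher complexity of the trace norm ball. -/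
lemma bernExp_iSup_traceNorm_le (hn : 0 < n) (hnm : n ≤ m) (hT : 0 < T) {γ a : ℝ} (ha : 0 ≤ a)
    [Nonempty {X : UnitMatrix n m // traceNorm X.toReal ≤ γ}] :
    bernExp (fun _ => 1 / 2) (fun ω : Fin T × Fin n × Fin m → Bool =>
      ⨆ X : {X : UnitMatrix n m // traceNorm X.toReal ≤ γ},
        ∑ k : Fin T × Fin n × Fin m, (a * (X.1 k.2.1 k.2.2 : ℝ)) * boolSign (ω k)) ≤
      a * γ * (140 * √(m * T)) := by
  obtain ⟨⟨X₀, hX₀⟩⟩ := ‹Nonempty {X : UnitMatrix n m // traceNorm X.toReal ≤ γ}›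
  have hγ : 0 ≤ γ := by
    refine le_trans ?_ hX₀
    rw [traceNorm_eq_sum]
    exact Finset.sum_nonneg fun k _ => LinearMap.singularValues_nonneg _ _
  refine le_trans (bernExp_mono (fun _ => by constructor <;> norm_num) fun ω => ?_)
    ((bernExp_const_mul (a * γ) _).trans_le (mul_le_mul_of_nonneg_left
      (bernExp_euclideanOpNorm_signSum_le hn hnm hT) (by positivity)))
  have : Nonempty {X : UnitMatrix n m // traceNorm X.toReal ≤ γ} := ⟨⟨X₀, hX₀⟩⟩
  refine ciSup_le fun X => ?_
  have h1 : ∑ k : Fin T × Fin n × Fin m, (a * (X.1 k.2.1 k.2.2 : ℝ)) * boolSign (ω k) =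
      a * ∑ i, ∑ j, X.1.toReal i j * signSum ω i j := by
    simp only [Fintype.sum_prod_type, signSum, UnitMatrix.toReal, Matrix.of_apply, Finset.mul_sum]
    rw [Finset.sum_comm]
    refine Finset.sum_congr rfl fun i _ => ?_
    rw [Finset.sum_comm]
    exact Finset.sum_congr rfl fun j _ => Finset.sum_congr rfl fun t _ => by ring
  rw [h1, mul_assoc]
  refine mul_le_mul_of_nonneg_left ((sum_mul_le_traceNorm_mul _ _).trans ?_) ha
  exact mul_le_mul_of_nonneg_right X.2 (norm_nonneg _)

lemma isLipschitzLoss_squaredLoss : IsLipschitzLoss 2 squaredLoss := by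
  have key : ∀ x x' y : I, |((x : ℝ) - y) ^ 2 - ((x' : ℝ) - y) ^ 2| ≤ 2 * |(x : ℝ) - x'| := by
    intro x x' y
    have h1 : ((x : ℝ) - y) ^ 2 - ((x' : ℝ) - y) ^ 2 = (x + x' - 2 * y) * (x - x') := by ring
    rw [h1, abs_mul]
    refine mul_le_mul_of_nonneg_right ?_ (abs_nonneg _)
    obtain ⟨hx0, hx1⟩ := x.2
    obtain ⟨hx0', hx1'⟩ := x'.2
    obtain ⟨hy0, hy1⟩ := y.2
    rw [abs_le]
    constructor <;> linarith
  refine ⟨fun x y => sq_nonneg _, key, fun x y y' => ?_⟩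
  have h2 := key y y' x
  rwa [sub_sq_comm (y : ℝ), sub_sq_comm (y' : ℝ)] at h2

end sample

/-- The uniform deviation bound over a trace norm ball. -/
lemma one_sub_le_sampleLaw {n m T : ℕ} (hn : 0 < n) (hnm : n ≤ m) (hT : 0 < T) {L : ℝ}
    (hL : 0 < L) {loss : I → I → ℝ} (hloss : IsLipschitzLoss L loss) (pbar : UnitMatrix n m)
    (γ : ℝ) {δ : ℝ} (hδ : 0 < δ) (hδ1 : δ < 1) :
    1 - δ ≤ (sampleLaw T pbar).real
      {S : Fin T → UnitMatrix n m | ∀ p : UnitMatrix n m, traceNorm p.toReal ≤ γ →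
        |trueLoss loss p (bernoulliMatrix pbar) - empiricalLoss loss p S| ≤
          280 * (L * γ / ((n : ℝ) * √((m : ℝ) * (T : ℝ)))) +
            L * √(Real.log (2 / δ) / (2 * (T : ℝ) * (m : ℝ) * (n : ℝ)))} := by
  classical
  have hm : 0 < m := hn.trans_le hnm
  have hn' : (0 : ℝ) < n := by exact_mod_cast hn
  have hm' : (0 : ℝ) < m := by exact_mod_cast hm
  have hT' : (0 : ℝ) < T := by exact_mod_cast hT
  -- An empty ball, as for negative `γ`, makes the event certain; the suprema below need a nonempty
  -- index.
  rcases isEmpty_or_nonempty {X : UnitMatrix n m // traceNorm X.toReal ≤ γ} with hK | hK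
  · have : {S : Fin T → UnitMatrix n m | ∀ p : UnitMatrix n m, traceNorm p.toReal ≤ γ →
        |trueLoss loss p (bernoulliMatrix pbar) - empiricalLoss loss p S| ≤
          280 * (L * γ / ((n : ℝ) * √((m : ℝ) * (T : ℝ)))) +
            L * √(Real.log (2 / δ) / (2 * (T : ℝ) * (m : ℝ) * (n : ℝ)))} = Set.univ :=
      Set.eq_univ_of_forall fun S p hp => (hK.false ⟨p, hp⟩).elim
    rw [this, probReal_univ]
    linarith
  set A := {S : Fin T → UnitMatrix n m | ∀ p : UnitMatrix n m, traceNorm p.toReal ≤ γ →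
        |trueLoss loss p (bernoulliMatrix pbar) - empiricalLoss loss p S| ≤
          280 * (L * γ / ((n : ℝ) * √((m : ℝ) * (T : ℝ)))) +
            L * √(Real.log (2 / δ) / (2 * (T : ℝ) * (m : ℝ) * (n : ℝ)))} with hA
  set R := 280 * (L * γ / ((n : ℝ) * √((m : ℝ) * (T : ℝ))))
  set ε := L * √(Real.log (2 / δ) / (2 * (T : ℝ) * (m : ℝ) * (n : ℝ))) with hε
  set N : ℝ := (n : ℝ) * m * T with hN
  have hN0 : 0 < N := by positivity
  let K := {X : UnitMatrix n m // traceNorm X.toReal ≤ γ}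
  let ι := Fin T × Fin n × Fin m
  let q : ι → ℝ := fun k => pbar k.2.1 k.2.2
  let h : ι → K → ℝ := fun k X => 1 / N * (loss (X.1 k.2.1 k.2.2) 1 - loss (X.1 k.2.1 k.2.2) 0)
  -- The factor `2 * L` is the Lipschitz constant of `x ↦ loss x 1 - loss x 0`, one `L` from each
  -- term; it doubles `140` to `280`.
  let t : ι → K → ℝ := fun k X => 2 * L / N * (X.1 k.2.1 k.2.2 : ℝ)
  have hq : ∀ k, q k ∈ Set.Icc (0 : ℝ) 1 := fun k => (pbar k.2.1 k.2.2).2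
  have hcard : (Fintype.card ι : ℝ) = N := by
    simp only [ι, Fintype.card_prod, Fintype.card_fin]
    push_cast
    ring
  have hh : ∀ k X, |h k X| ≤ L / N := by
    intro k X
    rw [abs_mul, abs_of_pos (by positivity), one_div_mul_eq_div]
    gcongr
    simpa using hloss.lipschitz_right (X.1 k.2.1 k.2.2) 1 0
  have ht : ∀ k X, |t k X| ≤ 2 * L / N := by
    intro k X
    rw [abs_mul, abs_of_pos (by positivity)]
    refine mul_le_of_le_one_right (by positivity) ?_
    rw [abs_of_nonneg (X.1 k.2.1 k.2.2).2.1]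
    exact (X.1 k.2.1 k.2.2).2.2
  have hht : ∀ k X Y, |h k X - h k Y| ≤ |t k X - t k Y| := by
    intro k X Y
    have e1 : h k X - h k Y = 1 / N * ((loss (X.1 k.2.1 k.2.2) 1 - loss (Y.1 k.2.1 k.2.2) 1) -
        (loss (X.1 k.2.1 k.2.2) 0 - loss (Y.1 k.2.1 k.2.2) 0)) := by simp only [h]; ring
    have e2 : t k X - t k Y =
        1 / N * (2 * L * ((X.1 k.2.1 k.2.2 : ℝ) - Y.1 k.2.1 k.2.2)) := by simp only [t]; ring
    rw [e1, e2, abs_mul, abs_mul]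
    refine mul_le_mul_of_nonneg_left ?_ (abs_nonneg _)
    rw [abs_mul, abs_of_pos (a := 2 * L) (by positivity)]
    refine (abs_sub _ _).trans ?_
    linarith [hloss.lipschitz_left (X.1 k.2.1 k.2.2) (Y.1 k.2.1 k.2.2) 1,
      hloss.lipschitz_left (X.1 k.2.1 k.2.2) (Y.1 k.2.1 k.2.2) 0]
  have hR : bernExp (fun _ => 1 / 2) (fun ω : ι → Bool => ⨆ X, ∑ k, t k X * boolSign (ω k)) ≤ R := by
    refine (bernExp_iSup_traceNorm_le hn hnm hT (by positivity)).trans (le_of_eq ?_)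
    have hs : (0 : ℝ) < √(m * T) := by positivity
    have hs2 : √((m : ℝ) * T) ^ 2 = m * T := Real.sq_sqrt (by positivity)
    have hN2 : N = n * √((m : ℝ) * T) ^ 2 := by rw [hs2, hN]; ring
    simp only [R]
    rw [hN2]
    field_simp
    ring
  have hlog : 0 ≤ Real.log (2 / δ) := Real.log_nonneg (by rw [le_div_iff₀ hδ]; linarith)
  have hε0 : 0 ≤ ε := by positivity
  have hc : 0 < (Fintype.card ι : ℝ) * (L / N) ^ 2 := by rw [hcard]; positivity
  -- Since `N * (L / N) ^ 2 = L ^ 2 / N`, the choice of `ε` makes each one-sided tail exactly `δ /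
  -- 2`.
  have hexp : Real.exp (-2 * ε ^ 2 / (Fintype.card ι * (L / N) ^ 2)) = δ / 2 := by
    have e1 : -2 * ε ^ 2 / (Fintype.card ι * (L / N) ^ 2) = -Real.log (2 / δ) := by
      rw [hcard, hε, mul_pow, Real.sq_sqrt (by positivity), hN]
      field_simp
    rw [e1, Real.exp_neg, Real.exp_log (by positivity), inv_div]
  have hLC : L / N ≤ 2 * L / N := by gcongr; linarith
  have htail := bernExp_exists_process_gt_le hq hc hLC hh ht hht hε0 hR
  -- The lower deviation: negating `h` preserves its size and increments, so the same `t` and `R`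
  -- serve.
  have htail' := bernExp_exists_process_gt_le (h := fun k X => -h k X) hq hc hLC
    (fun k X => (abs_neg _).trans_le (hh k X)) ht
    (fun k X Y => by
      rw [neg_sub_neg, abs_sub_comm]
      exact hht k X Y) hε0 hR
  rw [hexp] at htail htail'
  have hgood := bernExp_indicator_le_sampleLaw pbar A
  have hunion : (1 : ℝ) ≤ bernExp q (fun ω => if boolSample ω ∈ A then 1 else 0) +
      bernExp q (fun ω => if ∃ X, R + ε < ∑ k, h k X * centred (q k) (ω k) then 1 else 0) +
      bernExp q (fun ω => if ∃ X, R + ε < ∑ k, -h k X * centred (q k) (ω k) then 1 else 0) := by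
    rw [← bernExp_add, ← bernExp_add]
    refine (bernExp_one (p := q)).symm.trans_le (bernExp_mono hq fun ω => ?_)
    by_cases h1 : boolSample ω ∈ A
    · rw [if_pos h1]
      split_ifs <;> norm_num
    rw [if_neg h1]
    simp only [hA, Set.mem_ofPred_eq, not_forall, not_le] at h1
    obtain ⟨X, hX, hlt⟩ := h1
    rw [trueLoss_sub_empiricalLoss hloss hL.le hT] at hlt
    rcases lt_abs.1 hlt with h2 | h2
    · rw [if_pos ⟨⟨X, hX⟩, h2⟩]
      split_ifs <;> norm_num
    · have h3 : ∃ X, R + ε < ∑ k, -h k X * centred (q k) (ω k) := by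
        refine ⟨⟨X, hX⟩, ?_⟩
        simpa only [neg_mul, Finset.sum_neg_distrib] using h2
      rw [if_pos h3]
      split_ifs <;> norm_num
  linarith

end MatrixLoss

theorem mainTheorem1 :
    MatrixLoss.IsLipschitzLoss 2 MatrixLoss.squaredLoss ∧
    ∃ c : ℝ, 0 < c ∧
      ∀ (n m T : ℕ), 0 < n → n ≤ m → 0 < T →
      ∀ (L : ℝ), 0 < L →
      ∀ (loss : I → I → ℝ), MatrixLoss.IsLipschitzLoss L loss →
      ∀ (pbar : MatrixLoss.UnitMatrix n m) (γ δ : ℝ), 0 < δ → δ < 1 →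
        1 - δ ≤ (MatrixLoss.sampleLaw T pbar).real
          {S : Fin T → MatrixLoss.UnitMatrix n m |
            ∀ p : MatrixLoss.UnitMatrix n m, MatrixLoss.traceNorm p.toReal ≤ γ →
              |MatrixLoss.trueLoss loss p (MatrixLoss.bernoulliMatrix pbar)
                  - MatrixLoss.empiricalLoss loss p S|
                ≤ c * (L * γ / ((n : ℝ) * Real.sqrt ((m : ℝ) * (T : ℝ))))
                  + L * Real.sqrt (Real.log (2 / δ) / (2 * (T : ℝ) * (m : ℝ) * (n : ℝ)))} := by
  refine ⟨MatrixLoss.isLipschitzLoss_squaredLoss, 280, by norm_num, ?_⟩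
  intro n m T hn hnm hT L hL loss hloss pbar γ δ hδ hδ1
  exact MatrixLoss.one_sub_le_sampleLaw hn hnm hT hL hloss pbar γ hδ hδ1
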